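/- Let $\Gamma=(V,E)$ be a simple digraph (no loops, no multiple edges) of order $n=|V|\ge 1$, and let $L=D-A$ be its Laplacian matrix, where $A$ is the adjacency matrix ($a_{ij}=1$ if $(i,j)\in E$ and $a_{ij}=0$ otherwise) and $D$ is the diagonal matrix of the out-degrees $d^+(i)$. For $n\ge 2$ put $$\alpha(\Gamma)=\min_{\substack{x\in\mathbb{R}^n,\ x\perp e\\ \|x\|=1}}x^{T}Lx,\qquad \beta(\Gamma)=\max_{\substack{x\in\mathbb{R}^n,\ x\perp e\\ \|x\|=1}}x^{T}Lx,$$ where $e$ is the all ones vector; the Laplacian spread of $\Gamma$ is $\beta(\Gamma)-\alpha(\Gamma)$. (For $n=1$ there is no such $x$, and the spread is read as $0$.) The digraph $\Gamma$ is balanced if $d^{+}(i)=d^{-}(i)$ for every vertex $i$, where $d^-(i)$ is the in-degree. Every balanced digraph $\Gamma$ of order $n$ has Laplacian spread $$\beta(\Gamma)-\alpha(\Gamma)\le n-1.$$ Moreover, for every $n\ge 3$ the bound is attained: the disjoint union $K_1\sqcup K_{n-1}$ of complete digraphs is balanced, of order $n$, and has Laplacian spread exactly $n-1$. -/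

import Mathlib

namespace Digraph

/-- A digraph is simple if it has no loops (multiple edges cannot occur, `Adj` being a relation). -/
def IsSimple {V : Type*} (Γ : Digraph V) : Prop :=
  ∀ i, ¬ Γ.Adj i i

/-- Out-degree: the number of edges `(i, j)`. -/
noncomputable def outDegree {V : Type*} (Γ : Digraph V) (i : V) : ℕ :=
  {j | Γ.Adj i j}.ncard

/-- In-degree: the number of edges `(j, i)`. -/
noncomputable def inDegree {V : Type*} (Γ : Digraph V) (i : V) : ℕ :=
  {j | Γ.Adj j i}.ncard

/-- A digraph is balanced if the out-degree and the in-degree of every vertex agree. -/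
def IsBalanced {V : Type*} (Γ : Digraph V) : Prop :=
  ∀ i, Γ.outDegree i = Γ.inDegree i

open Classical in
/-- The adjacency matrix, with entry `1` at `(i, j)` if `(i, j)` is an edge and `0` otherwise. -/
noncomputable def adjacencyMatrix {V : Type*} (Γ : Digraph V) : Matrix V V ℝ :=
  Matrix.of fun i j => if Γ.Adj i j then 1 else 0

open Classical in
/-- The Laplacian matrix `L = D - A`, with `D` the diagonal matrix of the out-degrees. -/
noncomputable def laplacian {V : Type*} (Γ : Digraph V) : Matrix V V ℝ :=
  Matrix.diagonal (fun i => (Γ.outDegree i : ℝ)) - Γ.adjacencyMatrix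

/-- The set of all values `xᵀ L x`, where `x` is a real vector of Euclidean norm one which is
orthogonal to the all ones vector. -/
noncomputable def laplacianValues {V : Type*} [Fintype V] (Γ : Digraph V) : Set ℝ :=
  {r | ∃ x : EuclideanSpace ℝ V,
    inner ℝ x (WithLp.toLp 2 fun _ => (1 : ℝ)) = 0 ∧ ‖x‖ = 1 ∧
      r = x.ofLp ⬝ᵥ (Γ.laplacian.mulVec x.ofLp)}

/-- The algebraic connectivity `α(Γ)`, the minimum of `xᵀ L x` over the unit vectors `x` orthogonal
to the all ones vector. On a single vertex, where there are no such vectors, it is `0`. -/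
noncomputable def alpha {V : Type*} [Fintype V] (Γ : Digraph V) : ℝ :=
  sInf Γ.laplacianValues

/-- The quantity `β(Γ)`, the maximum of `xᵀ L x` over the unit vectors `x` orthogonal
to the all ones vector. On a single vertex, where there are no such vectors, it is `0`. -/
noncomputable def beta {V : Type*} [Fintype V] (Γ : Digraph V) : ℝ :=
  sSup Γ.laplacianValues

/-- The Laplacian spread. -/
noncomputable def laplacianSpread {V : Type*} [Fintype V] (Γ : Digraph V) : ℝ :=
  Γ.beta - Γ.alpha

/-- The complete simple digraph `Kₘ` of order `m`: all edges `(i, j)` with `i ≠ j`. -/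
def simpleComplete (m : ℕ) : Digraph (Fin m) where
  Adj i j := i ≠ j

/-- The disjoint union of two digraphs: the edges of both, and none between them. -/
def disjointUnion {V W : Type*} (Γ : Digraph V) (Δ : Digraph W) : Digraph (V ⊕ W) where
  Adj := Sum.LiftRel Γ.Adj Δ.Adj

end Digraph

/-! For a balanced digraph `xᵀ L x` is the symmetric form ½ ∑ aᵢⱼ (xᵢ - xⱼ)², so a minimiser x and a
maximiser y are orthogonal unless α = β. Since 0 ≤ aᵢⱼ ≤ 1, one gets 2(β - α) ≤ 2n - ∑ min((xᵢ -
xⱼ)², (yᵢ - yⱼ)²), and the bound reduces to `two_le_sum_min_sub_sq`.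

For that, rotate to u, v = (x ± y)/√2 and let R hold where the x-difference is the smaller one. It
suffices that |u ⬝ Sv| ≤ n - 1, where S is the Laplacian of the complete graph signed by R
(`sum_mul_signed_sq_le`). As u ⟂ v, Cauchy–Schwarz bounds the square of the left side by |Sv|² - (v
⬝ Sv)². Let P and N be the `relSum` of R and of its complement, and C the sum of the two cherry
sums. Then P + N = 2n, v ⬝ Sv = (P - N)/2 and |Sv|² = n² - 2C (`sum_sq_signed_eq`), so P ≤ C or N ≤
C is enough.

That alternative is the combinatorial core, `relSum_le_cherrySum_or`. The pairs that the cherries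
miss are dominating. A dominating pair of R and one of the complement span an induced path on four
vertices, whose four cross pairs pay for both. -/

section SignedTriples

/-! ### Induced cherries and dominating pairs of a symmetric relation. -/

open Finset

variable {V : Type*}

variable [Fintype V] in
/-- The ordered pairs related by `R` such that every vertex is related to one of the two. -/
noncomputable def dominatingPairs (R : V → V → Prop) : Finset (V × V) :=
  open Classical in univ.filter fun p => R p.1 p.2 ∧ ∀ i, R i p.1 ∨ R i p.2

/-- The squared difference `(v j - v k) ^ 2` if `j, k` are unrelated but both related to `i`. -/
noncomputable def cherryTerm (R : V → V → Prop) (v : V → ℝ) (i j k : V) : ℝ :=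
  open Classical in if R i j ∧ R i k ∧ ¬ R j k then (v j - v k) ^ 2 else 0

variable [Fintype V] in
/-- The sum of the squared differences over the pairs of endpoints of induced cherries of `R`. -/
noncomputable def cherrySum (R : V → V → Prop) (v : V → ℝ) : ℝ :=
  ∑ i, ∑ j, ∑ k, cherryTerm R v i j k

theorem cherryTerm_nonneg (R : V → V → Prop) (v : V → ℝ) (i j k : V) :
    0 ≤ cherryTerm R v i j k := by
  unfold cherryTerm; split_ifs <;> positivity

theorem cherryTerm_of_pos {R : V → V → Prop} {i j k : V} (hij : R i j) (hik : R i k)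
    (hjk : ¬ R j k) (v : V → ℝ) : cherryTerm R v i j k = (v j - v k) ^ 2 :=
  if_pos ⟨hij, hik, hjk⟩

theorem cherryTerm_swap {R : V → V → Prop} (hR : ∀ i j, R i j ↔ R j i) (v : V → ℝ) (i j k : V) :
    cherryTerm R v i j k = cherryTerm R v i k j := by
  unfold cherryTerm
  rw [hR j k, sub_sq_comm (v j)]
  congr 1
  exact propext (by tauto)

variable [Fintype V]

theorem mem_dominatingPairs {R : V → V → Prop} {p : V × V} :
    p ∈ dominatingPairs R ↔ R p.1 p.2 ∧ ∀ i, R i p.1 ∨ R i p.2 := by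
  simp [dominatingPairs]

theorem sum_dominatingPairs_swap {R : V → V → Prop} (hR : ∀ i j, R i j ↔ R j i)
    (f : V × V → ℝ) :
    ∑ p ∈ dominatingPairs R, f p.swap = ∑ p ∈ dominatingPairs R, f p := by
  refine Finset.sum_equiv (Equiv.prodComm V V) ?_ (fun p _ => rfl)
  intro p
  simp only [mem_dominatingPairs, Equiv.prodComm_apply, Prod.fst_swap, Prod.snd_swap]
  rw [hR p.1 p.2]
  simp only [or_comm]

/-- The cherries counted have one end in `{c, d}` and the other outside. The full sum contains each
of them twice, once per order of the ends; hence the factor 2. -/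
theorem two_mul_sum_dominatingPairs_le_cherrySum {R : V → V → Prop} (hR : ∀ i j, R i j ↔ R j i)
    (v : V → ℝ) {c d : V} (hcd : c ≠ d)
    (hD : ∀ p ∈ dominatingPairs R, p.2 ≠ c ∧ p.2 ≠ d) :
    2 * ∑ p ∈ dominatingPairs R, (cherryTerm R v p.1 p.2 c + cherryTerm R v p.1 p.2 d) ≤
      cherrySum R v := by
  classical
  set D : Finset V := {c, d} with hDdef
  have h1 : ∑ p ∈ dominatingPairs R, (cherryTerm R v p.1 p.2 c + cherryTerm R v p.1 p.2 d) ≤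
      ∑ i, ∑ j ∈ Dᶜ, ∑ k ∈ D, cherryTerm R v i j k := by
    have : ∑ i, ∑ j ∈ Dᶜ, ∑ k ∈ D, cherryTerm R v i j k =
        ∑ p ∈ (univ : Finset V) ×ˢ Dᶜ,
          (cherryTerm R v p.1 p.2 c + cherryTerm R v p.1 p.2 d) := by
      rw [Finset.sum_product]
      refine Finset.sum_congr rfl fun i _ => Finset.sum_congr rfl fun j _ => ?_
      rw [hDdef, Finset.sum_pair hcd]
    rw [this]
    refine Finset.sum_le_sum_of_subset_of_nonneg ?_ fun p _ _ =>
      add_nonneg (cherryTerm_nonneg _ _ _ _ _) (cherryTerm_nonneg _ _ _ _ _)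
    intro p hp
    have := hD p hp
    simp [hDdef, this.1, this.2]
  have h2 : ∀ i, 2 * ∑ j ∈ Dᶜ, ∑ k ∈ D, cherryTerm R v i j k ≤
      ∑ j, ∑ k, cherryTerm R v i j k := by
    intro i
    have hs : ∑ j ∈ Dᶜ, ∑ k ∈ D, cherryTerm R v i j k =
        ∑ j ∈ D, ∑ k ∈ Dᶜ, cherryTerm R v i j k := by
      rw [Finset.sum_comm]
      exact Finset.sum_congr rfl fun j _ => Finset.sum_congr rfl fun k _ =>
        cherryTerm_swap hR v i k j
    have ha : ∑ j ∈ D, ∑ k ∈ Dᶜ, cherryTerm R v i j k ≤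
        ∑ j ∈ D, ∑ k, cherryTerm R v i j k :=
      Finset.sum_le_sum fun j _ => Finset.sum_le_sum_of_subset_of_nonneg (Finset.subset_univ _)
        fun k _ _ => cherryTerm_nonneg _ _ _ _ _
    have hb : ∑ j ∈ Dᶜ, ∑ k ∈ D, cherryTerm R v i j k ≤
        ∑ j ∈ Dᶜ, ∑ k, cherryTerm R v i j k :=
      Finset.sum_le_sum fun j _ => Finset.sum_le_sum_of_subset_of_nonneg (Finset.subset_univ _)
        fun k _ _ => cherryTerm_nonneg _ _ _ _ _
    have hc := Finset.sum_add_sum_compl D fun j => ∑ k, cherryTerm R v i j k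
    linarith
  calc _ ≤ 2 * ∑ i, ∑ j ∈ Dᶜ, ∑ k ∈ D, cherryTerm R v i j k := by linarith
    _ ≤ _ := by
      rw [Finset.mul_sum]
      exact Finset.sum_le_sum fun i _ => h2 i

/-- An edge dominating `R` and an edge dominating the complement of `R` span an induced path, and
the four differences across it dominate the two differences along the given edges. -/
theorem sq_add_sq_le_cherryTerm {R : V → V → Prop} (hR : ∀ i j, R i j ↔ R j i) (v : V → ℝ)
    {p q : V × V} (hp : p ∈ dominatingPairs R)
    (hq : q ∈ dominatingPairs fun i j => ¬ R i j) :
    (v p.1 - v p.2) ^ 2 + (v q.1 - v q.2) ^ 2 ≤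
      (cherryTerm R v p.1 p.2 q.1 + cherryTerm R v p.1 p.2 q.2) +
      (cherryTerm R v p.2 p.1 q.1 + cherryTerm R v p.2 p.1 q.2) +
      ((cherryTerm (fun i j => ¬ R i j) v q.1 q.2 p.1 +
        cherryTerm (fun i j => ¬ R i j) v q.1 q.2 p.2) +
      (cherryTerm (fun i j => ¬ R i j) v q.2 q.1 p.1 +
        cherryTerm (fun i j => ¬ R i j) v q.2 q.1 p.2)) := by
  obtain ⟨a, b⟩ := p
  obtain ⟨c, d⟩ := q
  rw [mem_dominatingPairs] at hp hq
  obtain ⟨hab, hp⟩ := hp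
  obtain ⟨hcd, hq⟩ := hq
  have hca := hp c
  have hda := hp d
  have hac := hq a
  have hbc := hq b
  dsimp only at *
  have hba := (hR a b).1 hab
  have hdc : ¬ R d c := fun h => hcd ((hR d c).1 h)
  rw [hR c a, hR c b] at hca
  rw [hR d a, hR d b] at hda
  have key : (v a - v b) ^ 2 + (v c - v d) ^ 2 ≤
      (v a - v c) ^ 2 + (v a - v d) ^ 2 + (v b - v c) ^ 2 + (v b - v d) ^ 2 := by
    -- The two sides differ by exactly this square.
    nlinarith [sq_nonneg (v a + v b - v c - v d)]
  have e1 := hR c a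
  have e2 := hR c b
  have e3 := hR d a
  have e4 := hR d b
  have nn := cherryTerm_nonneg R v
  have nn' := cherryTerm_nonneg (fun i j => ¬ R i j) v
  -- The induced path is c–a–b–d or c–b–a–d. Of the four cross pairs, the two unrelated ones end
  -- cherries of `R` and the two related ones end cherries of the complement.
  by_cases h1 : R a c
  · have h2 : ¬ R a d := hac.resolve_left (not_not.2 h1)
    have h3 : R b d := hda.resolve_left h2
    have h4 : ¬ R b c := hbc.resolve_right (not_not.2 h3)
    have t1 := cherryTerm_of_pos hab h1 h4 v
    have t2 := cherryTerm_of_pos hba h3 h2 v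
    have t3 := cherryTerm_of_pos (R := fun i j => ¬ R i j) hcd (mt e2.1 h4)
      (not_not.2 (e4.2 h3)) v
    have t4 := cherryTerm_of_pos (R := fun i j => ¬ R i j) hdc (mt e3.1 h2)
      (not_not.2 (e1.2 h1)) v
    linarith [sub_sq_comm (v d) (v b), sub_sq_comm (v c) (v a), nn a b d, nn b a c,
      nn' c d a, nn' d c b]
  · have h4 : R b c := hca.resolve_left h1
    have h3 : ¬ R b d := hbc.resolve_left (not_not.2 h4)
    have h2 : R a d := hda.resolve_right h3
    have t1 := cherryTerm_of_pos hab h2 h3 v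
    have t2 := cherryTerm_of_pos hba h4 h1 v
    have t3 := cherryTerm_of_pos (R := fun i j => ¬ R i j) hcd (mt e1.1 h1)
      (not_not.2 (e3.2 h2)) v
    have t4 := cherryTerm_of_pos (R := fun i j => ¬ R i j) hdc (mt e4.1 h3)
      (not_not.2 (e2.2 h4)) v
    linarith [sub_sq_comm (v d) (v a), sub_sq_comm (v c) (v b), nn a b c, nn b a d,
      nn' c d b, nn' d c a]

/-- The sum of the squared differences over the pairs related by `R`. -/
noncomputable def relSum (R : V → V → Prop) (v : V → ℝ) : ℝ :=
  open Classical in ∑ j, ∑ k, if R j k then (v j - v k) ^ 2 else 0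

theorem relSum_add_relSum_not (R : V → V → Prop) (v : V → ℝ) :
    relSum R v + relSum (fun i j => ¬ R i j) v = ∑ j, ∑ k, (v j - v k) ^ 2 := by
  simp only [relSum, ← Finset.sum_add_distrib]
  refine Finset.sum_congr rfl fun j _ => Finset.sum_congr rfl fun k _ => ?_
  by_cases h : R j k <;> simp [h]

/-- An unrelated pair either has a common `R`-neighbour, and so ends a cherry of `R`, or has none,
which says that it dominates the complement. -/
theorem relSum_not_le (R : V → V → Prop) (v : V → ℝ) :
    relSum (fun i j => ¬ R i j) v ≤ cherrySum R v +
      ∑ p ∈ dominatingPairs (fun i j => ¬ R i j), (v p.1 - v p.2) ^ 2 := by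
  classical
  have h1 : ∑ p ∈ dominatingPairs (fun i j => ¬ R i j), (v p.1 - v p.2) ^ 2 =
      ∑ j, ∑ k, if (¬ R j k ∧ ∀ i, ¬ R i j ∨ ¬ R i k) then (v j - v k) ^ 2 else 0 := by
    rw [dominatingPairs, Finset.sum_filter, ← Finset.univ_product_univ, Finset.sum_product]
    refine Finset.sum_congr rfl fun j _ => Finset.sum_congr rfl fun k _ => ?_
    congr
  have h2 : cherrySum R v = ∑ j, ∑ k, ∑ i, cherryTerm R v i j k := by
    rw [cherrySum, Finset.sum_comm]
    exact Finset.sum_congr rfl fun j _ => Finset.sum_comm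
  rw [h1, h2, relSum]
  simp only [← Finset.sum_add_distrib]
  refine Finset.sum_le_sum fun j _ => Finset.sum_le_sum fun k _ => ?_
  have h0 : 0 ≤ ∑ i, cherryTerm R v i j k :=
    Finset.sum_nonneg fun i _ => cherryTerm_nonneg _ _ _ _ _
  by_cases hjk : R j k
  · simpa [hjk] using h0
  · by_cases hd : ∀ i, ¬ R i j ∨ ¬ R i k
    · simpa [hjk, hd] using h0
    · obtain ⟨i, hi⟩ := not_forall.1 hd
      have hi' : R i j ∧ R i k := by tauto
      have := Finset.single_le_sum (f := fun i => cherryTerm R v i j k)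
        (fun i _ => cherryTerm_nonneg _ _ _ _ _) (Finset.mem_univ i)
      have he : cherryTerm R v i j k = (v j - v k) ^ 2 := by
        simp [cherryTerm, hi'.1, hi'.2, hjk]
      rw [if_pos hjk, if_neg (fun h => hd h.2)]
      linarith

/-- Sum `sq_add_sq_le_cherryTerm` over all `p ∈ A`, `q ∈ C`. For fixed `q` the `R`-cherries arising
are distinct as `p` varies, so each `q` costs at most one `cherrySum R v`; symmetrically for each
`p`. -/
theorem card_mul_cherrySum_add_le {R : V → V → Prop} (hR : ∀ i j, R i j ↔ R j i)
    (hrefl : ∀ i, R i i) (v : V → ℝ) :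
    (#(dominatingPairs fun i j => ¬ R i j) : ℝ) * ∑ p ∈ dominatingPairs R, (v p.1 - v p.2) ^ 2 +
      (#(dominatingPairs R) : ℝ) *
        ∑ q ∈ dominatingPairs (fun i j => ¬ R i j), (v q.1 - v q.2) ^ 2 ≤
    (#(dominatingPairs fun i j => ¬ R i j) : ℝ) * cherrySum R v +
      (#(dominatingPairs R) : ℝ) * cherrySum (fun i j => ¬ R i j) v := by
  have hR' : ∀ i j, ¬ R i j ↔ ¬ R j i := fun i j => not_congr (hR i j)
  set A := dominatingPairs R with hA
  set C := dominatingPairs (fun i j => ¬ R i j) with hC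
  let N : V × V → V × V → ℝ := fun p q =>
    cherryTerm R v p.1 p.2 q.1 + cherryTerm R v p.1 p.2 q.2
  let M : V × V → V × V → ℝ := fun q p =>
    cherryTerm (fun i j => ¬ R i j) v q.1 q.2 p.1 + cherryTerm (fun i j => ¬ R i j) v q.1 q.2 p.2
  have hdisj : ∀ p ∈ A, ∀ q ∈ C, p.1 ≠ p.2 ∧ q.1 ≠ q.2 ∧ p.2 ≠ q.1 ∧ p.2 ≠ q.2 ∧
      q.2 ≠ p.1 ∧ q.2 ≠ p.2 := by
    rintro ⟨a, b⟩ hp ⟨c, d⟩ hq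
    rw [mem_dominatingPairs] at hp hq
    obtain ⟨hab, hp⟩ := hp
    obtain ⟨hcd, hq⟩ := hq
    have hca := hp c
    have hda := hp d
    have hac := hq a
    have hbc := hq b
    dsimp only at *
    refine ⟨?_, ?_, ?_, ?_, ?_, ?_⟩ <;> grind
  have hN : ∀ q ∈ C, 2 * ∑ p ∈ A, N p q ≤ cherrySum R v := by
    intro q hq
    by_cases hne : A.Nonempty
    · obtain ⟨p₀, hp₀⟩ := hne
      exact two_mul_sum_dominatingPairs_le_cherrySum hR v (hdisj p₀ hp₀ q hq).2.1
        fun p hp => ⟨(hdisj p hp q hq).2.2.1, (hdisj p hp q hq).2.2.2.1⟩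
    · rw [Finset.not_nonempty_iff_eq_empty.1 hne]
      simpa [cherrySum] using Finset.sum_nonneg fun i _ => Finset.sum_nonneg fun j _ =>
        Finset.sum_nonneg fun k _ => cherryTerm_nonneg R v i j k
  have hM : ∀ p ∈ A, 2 * ∑ q ∈ C, M q p ≤ cherrySum (fun i j => ¬ R i j) v := by
    intro p hp
    by_cases hne : C.Nonempty
    · obtain ⟨q₀, hq₀⟩ := hne
      exact two_mul_sum_dominatingPairs_le_cherrySum hR' v (hdisj p hp q₀ hq₀).1
        fun q hq => ⟨(hdisj p hp q hq).2.2.2.2.1, (hdisj p hp q hq).2.2.2.2.2⟩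
    · rw [Finset.not_nonempty_iff_eq_empty.1 hne]
      simpa [cherrySum] using Finset.sum_nonneg fun i _ => Finset.sum_nonneg fun j _ =>
        Finset.sum_nonneg fun k _ => cherryTerm_nonneg (fun i j => ¬ R i j) v i j k
  -- `A` is closed under swapping, so both orientations contribute equally.
  have sN : ∑ q ∈ C, ∑ p ∈ A, (N p q + N p.swap q) = ∑ q ∈ C, 2 * ∑ p ∈ A, N p q := by
    refine Finset.sum_congr rfl fun q _ => ?_
    rw [Finset.sum_add_distrib, sum_dominatingPairs_swap hR fun p => N p q]
    ring
  have sM : ∑ q ∈ C, ∑ p ∈ A, (M q p + M q.swap p) = ∑ p ∈ A, 2 * ∑ q ∈ C, M q p := by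
    rw [Finset.sum_comm]
    refine Finset.sum_congr rfl fun p _ => ?_
    rw [Finset.sum_add_distrib, sum_dominatingPairs_swap hR' fun q => M q p]
    ring
  have hle : ∑ q ∈ C, ∑ p ∈ A, ((v p.1 - v p.2) ^ 2 + (v q.1 - v q.2) ^ 2) ≤
      ∑ q ∈ C, ∑ p ∈ A, ((N p q + N p.swap q) + (M q p + M q.swap p)) :=
    Finset.sum_le_sum fun q hq => Finset.sum_le_sum fun p hp =>
      sq_add_sq_le_cherryTerm hR v hp hq
  have h1 := Finset.sum_le_card_nsmul C _ _ hN
  have h2 := Finset.sum_le_card_nsmul A _ _ hM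
  simp only [Finset.sum_add_distrib, Finset.sum_const, nsmul_eq_mul] at hle sN sM h1 h2
  rw [← Finset.mul_sum] at hle
  linarith

/-- The squared differences over the induced cherries of `R` and of its complement dominate those
over all related pairs or those over all unrelated pairs. -/
theorem relSum_le_cherrySum_or {R : V → V → Prop} (hR : ∀ i j, R i j ↔ R j i)
    (hrefl : ∀ i, R i i) (v : V → ℝ) :
    relSum R v ≤ cherrySum R v + cherrySum (fun i j => ¬ R i j) v ∨
      relSum (fun i j => ¬ R i j) v ≤ cherrySum R v + cherrySum (fun i j => ¬ R i j) v := by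
  have h1 := relSum_not_le R v
  have h2 := relSum_not_le (fun i j => ¬ R i j) v
  simp only [not_not] at h2
  have h3 := card_mul_cherrySum_add_le hR hrefl v
  have hnn : ∀ R : V → V → Prop, 0 ≤ cherrySum R v := fun R =>
    Finset.sum_nonneg fun i _ => Finset.sum_nonneg fun j _ =>
        Finset.sum_nonneg fun k _ => cherryTerm_nonneg R v i j k
  have n1 := hnn R
  have n2 := hnn (fun i j => ¬ R i j)
  set A := dominatingPairs R with hA
  set C := dominatingPairs (fun i j => ¬ R i j) with hC
  by_contra! hcon
  obtain ⟨k1, k2⟩ := hcon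
  have l1 : cherrySum R v < ∑ p ∈ A, (v p.1 - v p.2) ^ 2 := by linarith
  have l2 : cherrySum (fun i j => ¬ R i j) v < ∑ p ∈ C, (v p.1 - v p.2) ^ 2 := by linarith
  have hCpos : (0 : ℝ) < #C := by
    rw [Nat.cast_pos, Finset.card_pos]
    by_contra hne
    rw [Finset.not_nonempty_iff_eq_empty.1 hne] at l2
    simp only [Finset.sum_empty] at l2
    linarith
  -- Weighting `l1` by `#C` and `l2` by `#A` contradicts `h3`.
  have := mul_lt_mul_of_pos_left l1 hCpos
  have := mul_le_mul_of_nonneg_left l2.le (Nat.cast_nonneg (α := ℝ) #A)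
  linarith

end SignedTriples

/-! ### The signed Laplacian and the inequality for two orthonormal vectors. -/

section Spread

open Finset

theorem eq_zero_of_forall_nonneg_mul_add_sq {b c : ℝ}
    (h : ∀ t : ℝ, 0 ≤ t * b + t ^ 2 * c) : b = 0 := by
  -- A step against the sign of `b`, short enough for the linear term to win; the `+ 1` covers `c =
  -- 0`.
  have h1 := h (-b / (|c| + 1))
  have hc : 0 < |c| + 1 := by positivity
  have e : -b / (|c| + 1) * b + (-b / (|c| + 1)) ^ 2 * c =
      -(b ^ 2 * (|c| + 1 - c)) / (|c| + 1) ^ 2 := by field_simp; ring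
  rw [e, neg_div, neg_nonneg] at h1
  have h2 : 1 ≤ |c| + 1 - c := by linarith [le_abs_self c]
  by_contra hb
  have : 0 < b ^ 2 * (|c| + 1 - c) / (|c| + 1) ^ 2 := by positivity
  linarith

variable {V : Type*}

/-- The sign `1` on the pairs related by `R` and `-1` on the others. -/
noncomputable def relSign (R : V → V → Prop) (i j : V) : ℝ :=
  open Classical in if R i j then 1 else -1

theorem relSign_comm {R : V → V → Prop} (hR : ∀ i j, R i j ↔ R j i) (i j : V) :
    relSign R i j = relSign R j i := by
  by_cases h : R i j
  · simp [relSign, h, (hR i j).1 h]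
  · simp [relSign, h, mt (hR i j).2 h]

variable [Fintype V]

theorem sum_sum_sub_sq (v : V → ℝ) (hv : ∑ i, v i = 0) :
    ∑ j, ∑ k, (v j - v k) ^ 2 = 2 * Fintype.card V * ∑ i, v i ^ 2 := by
  simp only [sub_sq, Finset.sum_add_distrib, Finset.sum_sub_distrib, ← Finset.mul_sum, hv,
    mul_zero, Finset.sum_const_zero, Finset.sum_const,
    Finset.card_univ, nsmul_eq_mul]
  ring

theorem sum_sum_mul_sub_eq (w : V → V → ℝ) (hw : ∀ i j, w i j = w j i) (u v : V → ℝ) :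
    ∑ i, u i * ∑ j, w i j * (v i - v j) =
      1 / 2 * ∑ i, ∑ j, w i j * ((u i - u j) * (v i - v j)) := by
  have h1 : ∑ i, u i * ∑ j, w i j * (v i - v j) = ∑ i, ∑ j, w i j * (u i * (v i - v j)) := by
    simp only [Finset.mul_sum]
    exact Finset.sum_congr rfl fun i _ => Finset.sum_congr rfl fun j _ => by ring
  have h2 : ∑ i, ∑ j, w i j * (u i * (v i - v j)) = ∑ i, ∑ j, w i j * (-u j * (v i - v j)) := by
    rw [Finset.sum_comm]
    exact Finset.sum_congr rfl fun i _ => Finset.sum_congr rfl fun j _ => by rw [hw]; ring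
  have h3 : ∑ i, ∑ j, w i j * ((u i - u j) * (v i - v j)) =
      ∑ i, ∑ j, w i j * (u i * (v i - v j)) + ∑ i, ∑ j, w i j * (-u j * (v i - v j)) := by
    simp only [← Finset.sum_add_distrib]
    exact Finset.sum_congr rfl fun i _ => Finset.sum_congr rfl fun j _ => by ring
  rw [h1, h3, ← h2]
  ring

/-- Compare with all signs equal to 1, where the inner sum is n vᵢ. Polarising (vᵢ - vⱼ)(vᵢ - vₖ)
and relabelling gives (vⱼ - vₖ)² the coefficient ½(1 - wⱼₖwᵢⱼ)(1 - wⱼₖwᵢₖ), which is 2 when wᵢⱼ =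
wᵢₖ = -wⱼₖ, on the cherries of `R` or of its complement, and 0 otherwise. -/
theorem sum_sq_signed_eq {R : V → V → Prop} (hR : ∀ i j, R i j ↔ R j i)
    (v : V → ℝ) (hv : ∑ i, v i = 0) :
    ∑ i, (∑ j, relSign R i j * (v i - v j)) ^ 2 =
      (Fintype.card V : ℝ) ^ 2 * ∑ i, v i ^ 2 -
        2 * (cherrySum R v + cherrySum (fun i j => ¬ R i j) v) := by
  set w := relSign R with hw
  have h0 : ∑ i, (∑ j, (v i - v j)) ^ 2 = (Fintype.card V : ℝ) ^ 2 * ∑ i, v i ^ 2 := by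
    simp [Finset.sum_sub_distrib, hv, mul_pow, Finset.mul_sum]
  let X : V → V → V → ℝ := fun i j k => (1 - w i j * w i k) * (v j - v k) ^ 2
  let Y : V → V → V → ℝ := fun i j k => (1 - w i j * w i k) * (v i - v j) ^ 2
  have h1 : ∑ i, (∑ j, (v i - v j)) ^ 2 - ∑ i, (∑ j, w i j * (v i - v j)) ^ 2 =
      ∑ i, ∑ j, ∑ k, 1 / 2 * (Y i j k + Y i k j - X i j k) := by
    rw [← Finset.sum_sub_distrib]
    refine Finset.sum_congr rfl fun i _ => ?_
    rw [sq, sq, Finset.sum_mul_sum, Finset.sum_mul_sum, ← Finset.sum_sub_distrib]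
    refine Finset.sum_congr rfl fun j _ => ?_
    rw [← Finset.sum_sub_distrib]
    exact Finset.sum_congr rfl fun k _ => by simp only [X, Y]; ring
  have hsym : ∀ i j, w i j = w j i := relSign_comm hR
  have c1 : ∑ i, ∑ j, ∑ k, Y i j k = ∑ i, ∑ j, ∑ k, (1 - w j k * w i j) * (v j - v k) ^ 2 := by
    rw [show ∑ i, ∑ j, ∑ k, (1 - w j k * w i j) * (v j - v k) ^ 2 =
      ∑ j, ∑ k, ∑ i, (1 - w j k * w i j) * (v j - v k) ^ 2 from by
        rw [Finset.sum_comm]; exact Finset.sum_congr rfl fun j _ => Finset.sum_comm]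
    exact Finset.sum_congr rfl fun i _ => Finset.sum_congr rfl fun j _ =>
      Finset.sum_congr rfl fun k _ => by simp only [Y, hsym k i]
  have c2 : ∑ i, ∑ j, ∑ k, Y i k j = ∑ i, ∑ j, ∑ k, (1 - w j k * w i k) * (v j - v k) ^ 2 := by
    have : ∑ i, ∑ j, ∑ k, Y i k j = ∑ i, ∑ j, ∑ k, Y i j k :=
      Finset.sum_congr rfl fun i _ => Finset.sum_comm
    rw [this, c1]
    refine Finset.sum_congr rfl fun i _ => ?_
    rw [Finset.sum_comm]
    exact Finset.sum_congr rfl fun j _ => Finset.sum_congr rfl fun k _ => by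
      rw [hsym k j, sub_sq_comm]
  have h2 : ∑ i, ∑ j, ∑ k, 1 / 2 * (Y i j k + Y i k j - X i j k) =
      2 * (cherrySum R v + cherrySum (fun i j => ¬ R i j) v) := by
    have : ∑ i, ∑ j, ∑ k, 1 / 2 * (Y i j k + Y i k j - X i j k) = 1 / 2 *
        (∑ i, ∑ j, ∑ k, Y i j k + ∑ i, ∑ j, ∑ k, Y i k j - ∑ i, ∑ j, ∑ k, X i j k) := by
      simp only [Finset.mul_sum, ← Finset.sum_add_distrib, ← Finset.sum_sub_distrib]
    rw [this, c1, c2, cherrySum, cherrySum]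
    simp only [Finset.mul_sum, ← Finset.sum_add_distrib, ← Finset.sum_sub_distrib]
    refine Finset.sum_congr rfl fun i _ => Finset.sum_congr rfl fun j _ =>
      Finset.sum_congr rfl fun k _ => ?_
    simp only [X, hw, relSign, cherryTerm]
    by_cases h1 : R i j <;> by_cases h2 : R i k <;> by_cases h3 : R j k <;>
      simp only [h1, h2, h3, not_true, not_false_eq_true, and_true, and_false,
        if_true, if_false] <;> ring
  linarith

theorem sum_mul_signed_sq_le {R : V → V → Prop} (hR : ∀ i j, R i j ↔ R j i)
    (hrefl : ∀ i, R i i) (u v : V → ℝ) (hv : ∑ i, v i = 0) (huv : ∑ i, u i * v i = 0)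
    (hu1 : ∑ i, u i ^ 2 = 1) (hv1 : ∑ i, v i ^ 2 = 1) :
    (∑ i, u i * ∑ j, relSign R i j * (v i - v j)) ^ 2 ≤ ((Fintype.card V : ℝ) - 1) ^ 2 := by
  have hsym := relSign_comm hR
  set c : V → ℝ := fun i => ∑ j, relSign R i j * (v i - v j) with hc
  set t := ∑ i, v i * c i with ht
  -- Removing the component of `c` along `v` is free since `u ⟂ v`, and it sharpens Cauchy–Schwarz
  -- by `t ^ 2`.
  have e1 : ∑ i, u i * c i = ∑ i, u i * (c i - t * v i) := by
    have : ∑ i, u i * (c i - t * v i) = ∑ i, u i * c i - t * ∑ i, u i * v i := by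
      rw [Finset.mul_sum, ← Finset.sum_sub_distrib]
      exact Finset.sum_congr rfl fun i _ => by ring
    rw [this, huv]; ring
  have e2 : ∑ i, (c i - t * v i) ^ 2 = ∑ i, c i ^ 2 - t ^ 2 := by
    have : ∑ i, (c i - t * v i) ^ 2 =
        ∑ i, c i ^ 2 - 2 * t * ∑ i, v i * c i + t ^ 2 * ∑ i, v i ^ 2 := by
      rw [mul_assoc 2 t, Finset.mul_sum _ _ t, Finset.mul_sum, Finset.mul_sum,
        ← Finset.sum_sub_distrib, ← Finset.sum_add_distrib]
      exact Finset.sum_congr rfl fun i _ => by ring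
    rw [this, hv1, ← ht]; ring
  have cs := Finset.sum_mul_sq_le_sq_mul_sq univ u fun i => c i - t * v i
  rw [← e1, hu1, one_mul, e2, sum_sq_signed_eq hR v hv, hv1] at cs
  have ht' : t = 1 / 2 * (relSum R v - relSum (fun i j => ¬ R i j) v) := by
    rw [ht, hc, sum_sum_mul_sub_eq _ hsym, relSum, relSum]
    simp only [← Finset.sum_sub_distrib]
    congr 1
    refine Finset.sum_congr rfl fun i _ => Finset.sum_congr rfl fun j _ => ?_
    by_cases h : R i j <;> simp [relSign, h] <;> ring
  have hPN := relSum_add_relSum_not R v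
  rw [sum_sum_sub_sq v hv, hv1] at hPN
  change (∑ i, u i * c i) ^ 2 ≤ _
  refine cs.trans ?_
  have hN : relSum (fun i j => ¬ R i j) v = 2 * Fintype.card V - relSum R v := by linarith
  rcases relSum_le_cherrySum_or hR hrefl v with h | h
  · rw [ht', hN]
    -- With P = `relSum R v`: n² - 2P - (P - n)² = (n - 1)² - (P - (n - 1))².
    nlinarith [sq_nonneg (relSum R v - (Fintype.card V - 1))]
  · rw [ht', hN]
    rw [hN] at h
    nlinarith [sq_nonneg (2 * Fintype.card V - relSum R v - (Fintype.card V - 1))]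

/-- For two orthonormal vectors orthogonal to the all ones vector, the minima of the squared
differences of their entries add up to at least one. -/
theorem two_le_sum_min_sub_sq [Nonempty V] (x y : V → ℝ) (hx : ∑ i, x i = 0) (hy : ∑ i, y i = 0)
    (hxy : ∑ i, x i * y i = 0) (hx1 : ∑ i, x i ^ 2 = 1) (hy1 : ∑ i, y i ^ 2 = 1) :
    2 ≤ ∑ i, ∑ j, min ((x i - x j) ^ 2) ((y i - y j) ^ 2) := by
  let R : V → V → Prop := fun i j => (x i - x j) ^ 2 ≤ (y i - y j) ^ 2
  have hR : ∀ i j, R i j ↔ R j i := fun i j => by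
    simp only [R, sub_sq_comm (x i), sub_sq_comm (y i)]
  have hrefl : ∀ i, R i i := fun i => by simp [R]
  set s : ℝ := √2⁻¹ with hs
  have hs2 : s ^ 2 = 1 / 2 := by rw [hs, Real.sq_sqrt (by norm_num)]; norm_num
  have hsym := relSign_comm hR
  have hu1 : ∑ i, (s * (x i + y i)) ^ 2 = 1 := by
    have : ∑ i, (s * (x i + y i)) ^ 2 =
        s ^ 2 * (∑ i, x i ^ 2 + 2 * ∑ i, x i * y i + ∑ i, y i ^ 2) := by
      rw [Finset.mul_sum, ← Finset.sum_add_distrib, ← Finset.sum_add_distrib, Finset.mul_sum]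
      exact Finset.sum_congr rfl fun i _ => by ring
    rw [this, hs2, hx1, hxy, hy1]; norm_num
  have hv1 : ∑ i, (s * (x i - y i)) ^ 2 = 1 := by
    have : ∑ i, (s * (x i - y i)) ^ 2 =
        s ^ 2 * (∑ i, x i ^ 2 - 2 * ∑ i, x i * y i + ∑ i, y i ^ 2) := by
      rw [Finset.mul_sum, ← Finset.sum_sub_distrib, ← Finset.sum_add_distrib, Finset.mul_sum]
      exact Finset.sum_congr rfl fun i _ => by ring
    rw [this, hs2, hx1, hxy, hy1]; norm_num
  have huv : ∑ i, (s * (x i + y i)) * (s * (x i - y i)) = 0 := by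
    have : ∑ i, (s * (x i + y i)) * (s * (x i - y i)) =
        s ^ 2 * (∑ i, x i ^ 2 - ∑ i, y i ^ 2) := by
      rw [← Finset.sum_sub_distrib, Finset.mul_sum]
      exact Finset.sum_congr rfl fun i _ => by ring
    rw [this, hx1, hy1]; ring
  have hv : ∑ i, s * (x i - y i) = 0 := by
    rw [← Finset.mul_sum, Finset.sum_sub_distrib, hx, hy]; ring
  have key := sum_mul_signed_sq_le hR hrefl _ _ hv huv hu1 hv1
  rw [sum_sum_mul_sub_eq _ hsym] at key
  -- min(p, q) = (p + q)/2 - |p - q|/2, and the sign of `R` turns (p - q)/2 into -|p - q|/2.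
  have e : ∑ i, ∑ j, relSign R i j *
      ((s * (x i + y i) - s * (x j + y j)) * (s * (x i - y i) - s * (x j - y j))) =
      ∑ i, ∑ j, min ((x i - x j) ^ 2) ((y i - y j) ^ 2) -
        1 / 2 * (∑ i, ∑ j, (x i - x j) ^ 2 + ∑ i, ∑ j, (y i - y j) ^ 2) := by
    simp only [← Finset.sum_add_distrib, Finset.mul_sum, ← Finset.sum_sub_distrib]
    refine Finset.sum_congr rfl fun i _ => Finset.sum_congr rfl fun j _ => ?_
    have e' : (s * (x i + y i) - s * (x j + y j)) * (s * (x i - y i) - s * (x j - y j)) =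
        1 / 2 * ((x i - x j) ^ 2 - (y i - y j) ^ 2) := by rw [← hs2]; ring
    rw [e']
    by_cases h : R i j
    · rw [min_eq_left h, relSign, if_pos h]; ring
    · rw [min_eq_right (not_le.1 h).le, relSign, if_neg h]; ring
  rw [e, sum_sum_sub_sq x hx, sum_sum_sub_sq y hy, hx1, hy1] at key
  have hcard : (1 : ℝ) ≤ Fintype.card V := by exact_mod_cast Fintype.card_pos
  have := (abs_le_of_sq_le_sq' key (by linarith)).1
  linarith

end Spread

/-! ### The Laplacian form of a balanced digraph and the upper bound on the spread. -/

namespace Digraph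

open Finset

section LaplacianForm

variable {V : Type*}

theorem outDegree_eq_sum [Fintype V] (Γ : Digraph V) (i : V) :
    (Γ.outDegree i : ℝ) = ∑ j, Γ.adjacencyMatrix i j := by
  classical
  simp [outDegree, adjacencyMatrix, Set.ncard_eq_toFinset_card']

theorem inDegree_eq_sum [Fintype V] (Γ : Digraph V) (i : V) :
    (Γ.inDegree i : ℝ) = ∑ j, Γ.adjacencyMatrix j i := by
  classical
  simp [inDegree, adjacencyMatrix, Set.ncard_eq_toFinset_card']

theorem adjacencyMatrix_nonneg (Γ : Digraph V) (i j : V) : 0 ≤ Γ.adjacencyMatrix i j := by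
  simp only [adjacencyMatrix, Matrix.of_apply]; split_ifs <;> norm_num

theorem adjacencyMatrix_le_one (Γ : Digraph V) (i j : V) : Γ.adjacencyMatrix i j ≤ 1 := by
  simp only [adjacencyMatrix, Matrix.of_apply]; split_ifs <;> norm_num

theorem isBalanced_of_symm (Γ : Digraph V) (h : ∀ i j, Γ.Adj i j ↔ Γ.Adj j i) :
    Γ.IsBalanced := fun i => by simp only [outDegree, inDegree, h i]

variable [Fintype V]

/-- The bilinear form `(x, y) ↦ (1 / 2) ∑ aᵢⱼ (xᵢ - xⱼ) (yᵢ - yⱼ)` of a digraph. -/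
noncomputable def dirichletForm (Γ : Digraph V) (x y : V → ℝ) : ℝ :=
  1 / 2 * ∑ i, ∑ j, Γ.adjacencyMatrix i j * ((x i - x j) * (y i - y j))

/-- Balance lets the degree term be written both as ∑ aᵢⱼ xᵢ² and as ∑ aᵢⱼ xⱼ², which completes the
squares. -/
theorem IsBalanced.dotProduct_laplacian_mulVec {Γ : Digraph V} (h : Γ.IsBalanced) (x : V → ℝ) :
    x ⬝ᵥ (Γ.laplacian.mulVec x) = Γ.dirichletForm x x := by
  classical
  have h1 : x ⬝ᵥ (Γ.laplacian.mulVec x) =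
      ∑ i, Γ.outDegree i * x i ^ 2 - ∑ i, ∑ j, Γ.adjacencyMatrix i j * (x i * x j) := by
    rw [dotProduct, ← Finset.sum_sub_distrib]
    refine Finset.sum_congr rfl fun i _ => ?_
    rw [laplacian, Matrix.sub_mulVec, Pi.sub_apply, Matrix.mulVec, Matrix.mulVec, dotProduct,
      dotProduct, mul_sub, Finset.mul_sum _ _ (x i)]
    congr 1
    · rw [Finset.sum_eq_single i]
      · simp; ring
      · intro j _ hj; simp [Matrix.diagonal_apply_ne' _ hj]
      · simp
    · rw [Finset.mul_sum]
      exact Finset.sum_congr rfl fun j _ => by ring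
  have h2 : ∑ i, (Γ.outDegree i : ℝ) * x i ^ 2 =
      ∑ i, ∑ j, Γ.adjacencyMatrix i j * x i ^ 2 := by
    simp only [outDegree_eq_sum, Finset.sum_mul]
  have h3 : ∑ i, (Γ.outDegree i : ℝ) * x i ^ 2 =
      ∑ i, ∑ j, Γ.adjacencyMatrix i j * x j ^ 2 := by
    rw [Finset.sum_comm]
    refine Finset.sum_congr rfl fun i _ => ?_
    rw [h i, inDegree_eq_sum, Finset.sum_mul]
  have h4 : ∑ i, ∑ j, Γ.adjacencyMatrix i j * ((x i - x j) * (x i - x j)) =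
      ∑ i, ∑ j, Γ.adjacencyMatrix i j * x i ^ 2 + ∑ i, ∑ j, Γ.adjacencyMatrix i j * x j ^ 2 -
        2 * ∑ i, ∑ j, Γ.adjacencyMatrix i j * (x i * x j) := by
    simp only [Finset.mul_sum, ← Finset.sum_add_distrib, ← Finset.sum_sub_distrib]
    exact Finset.sum_congr rfl fun i _ => Finset.sum_congr rfl fun j _ => by ring
  rw [dirichletForm, h4, ← h2, ← h3, h1]
  ring

theorem dirichletForm_add_smul (Γ : Digraph V) (x z : V → ℝ) (t : ℝ) :
    Γ.dirichletForm (x + t • z) (x + t • z) =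
      Γ.dirichletForm x x + 2 * t * Γ.dirichletForm x z + t ^ 2 * Γ.dirichletForm z z := by
  simp only [dirichletForm, Finset.mul_sum, ← Finset.sum_add_distrib]
  exact Finset.sum_congr rfl fun i _ => Finset.sum_congr rfl fun j _ => by
    simp only [Pi.add_apply, Pi.smul_apply, smul_eq_mul]; ring

theorem dirichletForm_smul (Γ : Digraph V) (x : V → ℝ) (t : ℝ) :
    Γ.dirichletForm (t • x) (t • x) = t ^ 2 * Γ.dirichletForm x x := by
  simp only [dirichletForm, Finset.mul_sum]
  exact Finset.sum_congr rfl fun i _ => Finset.sum_congr rfl fun j _ => by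
    simp only [Pi.smul_apply, smul_eq_mul]; ring

theorem dirichletForm_comm (Γ : Digraph V) (x y : V → ℝ) :
    Γ.dirichletForm x y = Γ.dirichletForm y x := by
  simp only [dirichletForm]
  congr 1
  exact Finset.sum_congr rfl fun i _ => Finset.sum_congr rfl fun j _ => by ring

theorem IsBalanced.mem_laplacianValues {Γ : Digraph V} (h : Γ.IsBalanced) {r : ℝ} :
    r ∈ Γ.laplacianValues ↔
      ∃ x : V → ℝ, ∑ i, x i = 0 ∧ ∑ i, x i ^ 2 = 1 ∧ r = Γ.dirichletForm x x := by
  have hn : ∀ x : EuclideanSpace ℝ V, ‖x‖ = 1 ↔ ∑ i, x i ^ 2 = 1 := fun x => by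
    rw [← EuclideanSpace.real_norm_sq_eq, pow_eq_one_iff_of_nonneg (norm_nonneg x) two_ne_zero]
  constructor
  · rintro ⟨x, h1, h2, h3⟩
    refine ⟨x.ofLp, ?_, (hn x).1 h2, by rw [h3, h.dotProduct_laplacian_mulVec]⟩
    simpa [PiLp.inner_apply] using h1
  · rintro ⟨x, h1, h2, h3⟩
    refine ⟨WithLp.toLp 2 x, ?_, (hn _).2 h2, by rw [h3, h.dotProduct_laplacian_mulVec]⟩
    simpa [PiLp.inner_apply] using h1

theorem IsBalanced.smul_mem_laplacianValues {Γ : Digraph V} (h : Γ.IsBalanced) {z : V → ℝ}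
    (hz : ∑ i, z i = 0) (hz0 : ∑ i, z i ^ 2 ≠ 0) :
    Γ.dirichletForm z z / ∑ i, z i ^ 2 ∈ Γ.laplacianValues := by
  have hpos : 0 ≤ ∑ i, z i ^ 2 := Finset.sum_nonneg fun i _ => sq_nonneg _
  have hs : (√(∑ i, z i ^ 2))⁻¹ ^ 2 = (∑ i, z i ^ 2)⁻¹ := by rw [inv_pow, Real.sq_sqrt hpos]
  refine h.mem_laplacianValues.2 ⟨(√(∑ i, z i ^ 2))⁻¹ • z, ?_, ?_, ?_⟩
  · simp [← Finset.mul_sum, hz]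
  · simp only [Pi.smul_apply, smul_eq_mul, mul_pow, ← Finset.mul_sum, hs]
    exact inv_mul_cancel₀ hz0
  · rw [dirichletForm_smul, hs, div_eq_inv_mul]

theorem isCompact_laplacianValues (Γ : Digraph V) : IsCompact Γ.laplacianValues := by
  have hK : IsCompact (Metric.sphere (0 : EuclideanSpace ℝ V) 1 ∩
      {x | inner ℝ x (WithLp.toLp 2 fun _ => (1 : ℝ)) = 0}) :=
    (isCompact_sphere _ _).inter_right (isClosed_eq (by fun_prop) continuous_const)
  have hc : Continuous fun x : EuclideanSpace ℝ V =>
      x.ofLp ⬝ᵥ (Γ.laplacian.mulVec x.ofLp) := by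
    simp only [dotProduct, Matrix.mulVec]
    fun_prop
  convert hK.image hc using 1
  ext r
  simp only [laplacianValues, Set.mem_ofPred_eq, Set.mem_image, Set.mem_inter_iff,
    mem_sphere_zero_iff_norm]
  exact ⟨fun ⟨x, h1, h2, h3⟩ => ⟨x, ⟨h2, h1⟩, h3.symm⟩,
    fun ⟨x, ⟨h2, h1⟩, h3⟩ => ⟨x, h1, h2, h3.symm⟩⟩

theorem IsBalanced.laplacianValues_nonempty {Γ : Digraph V} (h : Γ.IsBalanced)
    (hV : 2 ≤ Fintype.card V) : Γ.laplacianValues.Nonempty := by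
  classical
  obtain ⟨a, b, hab⟩ := Fintype.exists_pair_of_one_lt_card hV
  refine ⟨_, h.smul_mem_laplacianValues (z := Pi.single a 1 - Pi.single b 1) ?_ ?_⟩
  · simp
  · have : 0 < ∑ i, (Pi.single a 1 - Pi.single b 1 : V → ℝ) i ^ 2 :=
      Finset.sum_pos' (fun i _ => sq_nonneg _) ⟨a, Finset.mem_univ a, by simp [hab]⟩
    exact this.ne'

theorem IsBalanced.isLeast_alpha {Γ : Digraph V} (h : Γ.IsBalanced) (hV : 2 ≤ Fintype.card V) :
    IsLeast Γ.laplacianValues Γ.alpha :=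
  Γ.isCompact_laplacianValues.isLeast_sInf (h.laplacianValues_nonempty hV)

theorem IsBalanced.isGreatest_beta {Γ : Digraph V} (h : Γ.IsBalanced)
    (hV : 2 ≤ Fintype.card V) : IsGreatest Γ.laplacianValues Γ.beta :=
  Γ.isCompact_laplacianValues.isGreatest_sSup (h.laplacianValues_nonempty hV)

theorem IsBalanced.alpha_mul_le {Γ : Digraph V} (h : Γ.IsBalanced) (hV : 2 ≤ Fintype.card V)
    {z : V → ℝ} (hz : ∑ i, z i = 0) : Γ.alpha * ∑ i, z i ^ 2 ≤ Γ.dirichletForm z z := by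
  rcases (Finset.sum_nonneg fun i (_ : i ∈ univ) => sq_nonneg (z i)).eq_or_lt with h0 | h0
  · have hz0 : z = 0 := funext fun i => by
      simpa using (Finset.sum_eq_zero_iff_of_nonneg fun i _ => sq_nonneg (z i)).1 h0.symm i
    simp [hz0, dirichletForm]
  · exact (le_div_iff₀ h0).1 ((h.isLeast_alpha hV).2 (h.smul_mem_laplacianValues hz h0.ne'))

theorem IsBalanced.le_beta_mul {Γ : Digraph V} (h : Γ.IsBalanced) (hV : 2 ≤ Fintype.card V)
    {z : V → ℝ} (hz : ∑ i, z i = 0) : Γ.dirichletForm z z ≤ Γ.beta * ∑ i, z i ^ 2 := by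
  rcases (Finset.sum_nonneg fun i (_ : i ∈ univ) => sq_nonneg (z i)).eq_or_lt with h0 | h0
  · have hz0 : z = 0 := funext fun i => by
      simpa using (Finset.sum_eq_zero_iff_of_nonneg fun i _ => sq_nonneg (z i)).1 h0.symm i
    simp [hz0, dirichletForm]
  · exact (div_le_iff₀ h0).1 ((h.isGreatest_beta hV).2 (h.smul_mem_laplacianValues hz h0.ne'))

theorem sum_add_smul_sq (x z : V → ℝ) (t : ℝ) :
    ∑ i, (x + t • z) i ^ 2 = ∑ i, x i ^ 2 + 2 * t * ∑ i, x i * z i + t ^ 2 * ∑ i, z i ^ 2 := by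
  simp only [Finset.mul_sum, ← Finset.sum_add_distrib]
  exact Finset.sum_congr rfl fun i _ => by
    simp only [Pi.add_apply, Pi.smul_apply, smul_eq_mul]; ring

theorem IsBalanced.laplacianSpread_le {Γ : Digraph V} [Nonempty V] (h : Γ.IsBalanced) :
    Γ.laplacianSpread ≤ (Fintype.card V : ℝ) - 1 := by
  have hcard : 1 ≤ Fintype.card V := Fintype.card_pos
  rcases hcard.eq_or_lt with h1 | hV
  -- On one vertex the set of values is empty, and `sInf ∅ = sSup ∅ = 0` in `ℝ`.
  · have : Subsingleton V := Fintype.card_le_one_iff_subsingleton.1 h1.ge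
    have he : Γ.laplacianValues = ∅ := by
      rw [Set.eq_empty_iff_forall_notMem]
      intro r hr
      obtain ⟨x, hx, hx1, -⟩ := h.mem_laplacianValues.1 hr
      have hx0 : ∀ i, x i = 0 := fun i => by
        rw [Finset.sum_eq_single i (fun j _ hj => (hj (Subsingleton.elim j i)).elim)
          (by simp)] at hx
        exact hx
      simp [hx0] at hx1
    simp [laplacianSpread, alpha, beta, he, ← h1]
  replace hV : 2 ≤ Fintype.card V := hV
  have hc2 : (2 : ℝ) ≤ Fintype.card V := by exact_mod_cast hV
  obtain ⟨x, hx, hx1, hxα⟩ := h.mem_laplacianValues.1 (h.isLeast_alpha hV).1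
  obtain ⟨y, hy, hy1, hyβ⟩ := h.mem_laplacianValues.1 (h.isGreatest_beta hV).1
  have hsum : ∀ (x z : V → ℝ) (t : ℝ), ∑ i, x i = 0 → ∑ i, z i = 0 →
      ∑ i, (x + t • z) i = 0 := fun x z t hx hz => by
    simp [Finset.sum_add_distrib, ← Finset.mul_sum, hx, hz]
  -- First variation at the minimiser `x` in direction `y`; `ey` is its counterpart at the
  -- maximiser. Together they give (β - α)⟨x, y⟩ = 0.
  have ex : 2 * (Γ.dirichletForm x y - Γ.alpha * ∑ i, x i * y i) = 0 :=
    eq_zero_of_forall_nonneg_mul_add_sq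
      (c := Γ.dirichletForm y y - Γ.alpha * ∑ i, y i ^ 2) fun t => by
    have := h.alpha_mul_le hV (hsum x y t hx hy)
    rw [dirichletForm_add_smul, sum_add_smul_sq, hx1, ← hxα] at this
    linarith
  have ey : 2 * (Γ.beta * (∑ i, y i * x i) - Γ.dirichletForm y x) = 0 :=
    eq_zero_of_forall_nonneg_mul_add_sq
      (c := Γ.beta * ∑ i, x i ^ 2 - Γ.dirichletForm x x) fun t => by
    have := h.le_beta_mul hV (hsum y x t hy hx)
    rw [dirichletForm_add_smul, sum_add_smul_sq, hy1, ← hyβ] at this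
    linarith
  simp only [mul_comm (y _) (x _)] at ey
  rw [Γ.dirichletForm_comm y x] at ey
  have hprod : (Γ.beta - Γ.alpha) * ∑ i, x i * y i = 0 := by linarith
  rcases mul_eq_zero.1 hprod with hd | hxy
  · rw [laplacianSpread, hd]; linarith
  have key := two_le_sum_min_sub_sq x y hx hy hxy hx1 hy1
  -- The minimum is at most the convex combination with weights aᵢⱼ and 1 - aᵢⱼ.
  have hmin : ∑ i, ∑ j, min ((x i - x j) ^ 2) ((y i - y j) ^ 2) ≤
      2 * Γ.dirichletForm x x - 2 * Γ.dirichletForm y y + ∑ i, ∑ j, (y i - y j) ^ 2 := by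
    simp only [dirichletForm, ← mul_assoc]
    norm_num only [one_mul]
    simp only [← Finset.sum_add_distrib, ← Finset.sum_sub_distrib]
    refine Finset.sum_le_sum fun i _ => Finset.sum_le_sum fun j _ => ?_
    have a0 := Γ.adjacencyMatrix_nonneg i j
    have a1 := sub_nonneg.2 (Γ.adjacencyMatrix_le_one i j)
    have b0 := mul_le_mul_of_nonneg_left (min_le_left ((x i - x j) ^ 2) ((y i - y j) ^ 2)) a0
    have b1 := mul_le_mul_of_nonneg_left (min_le_right ((x i - x j) ^ 2) ((y i - y j) ^ 2)) a1
    linarith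
  rw [sum_sum_sub_sq y hy, hy1, ← hxα, ← hyβ] at hmin
  rw [laplacianSpread]
  linarith

end LaplacianForm

/-! ### The extremal digraph: an isolated vertex beside a complete digraph. -/

section Extremal

theorem isSimple_simpleComplete (m : ℕ) : (simpleComplete m).IsSimple := fun _ h => h rfl

theorem IsSimple.disjointUnion {V W : Type*} {Γ : Digraph V} {Δ : Digraph W} (hΓ : Γ.IsSimple)
    (hΔ : Δ.IsSimple) : (Γ.disjointUnion Δ).IsSimple := by
  rintro (i | i) h
  · exact hΓ i (Sum.liftRel_inl_inl.1 h)
  · exact hΔ i (Sum.liftRel_inr_inr.1 h)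

theorem isBalanced_disjointUnion_simpleComplete (l m : ℕ) :
    ((simpleComplete l).disjointUnion (simpleComplete m)).IsBalanced := by
  refine isBalanced_of_symm _ ?_
  rintro (i | i) (j | j) <;> simp [disjointUnion, simpleComplete, eq_comm]

theorem laplacianSpread_disjointUnion_simpleComplete {m : ℕ} (hm : 2 ≤ m) :
    ((simpleComplete 1).disjointUnion (simpleComplete m)).laplacianSpread = m := by
  set Γ := (simpleComplete 1).disjointUnion (simpleComplete m) with hΓ
  have hb : Γ.IsBalanced := isBalanced_disjointUnion_simpleComplete 1 m
  have hc : Fintype.card (Fin 1 ⊕ Fin m) = m + 1 := by simp [add_comm]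
  have hV : 2 ≤ Fintype.card (Fin 1 ⊕ Fin m) := by omega
  have hm0 : (2 : ℝ) ≤ m := by exact_mod_cast hm
  have hform : ∀ x : Fin 1 ⊕ Fin m → ℝ, Γ.dirichletForm x x =
      1 / 2 * ∑ i, ∑ j, (x (Sum.inr i) - x (Sum.inr j)) ^ 2 := fun x => by
    rw [dirichletForm]
    congr 1
    simp only [Fintype.sum_sum_type, adjacencyMatrix, Matrix.of_apply, hΓ, disjointUnion,
      simpleComplete]
    simp only [Sum.liftRel_inl_inl, Sum.liftRel_inr_inr, Sum.not_liftRel_inl_inr,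
      Sum.not_liftRel_inr_inl, Finset.univ_unique, Finset.sum_singleton, if_false, zero_mul,
      Finset.sum_const_zero, sub_self, mul_zero, zero_add]
    refine Finset.sum_congr rfl fun i _ => Finset.sum_congr rfl fun j _ => ?_
    by_cases hij : i = j
    · simp [hij]
    · simp [hij, sq]
  have hle : Γ.laplacianSpread ≤ m := by
    have := hb.laplacianSpread_le
    rw [hc] at this
    push_cast at this
    linarith
  have hα : Γ.alpha ≤ 0 := by
    -- A zero-sum vector constant on each component, on which the form vanishes.
    have h := hb.alpha_mul_le hV (z := Sum.elim (fun _ => (m : ℝ)) fun _ => -1) (by simp)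
    rw [hform] at h
    simp only [Fintype.sum_sum_type, Sum.elim_inl, Sum.elim_inr, Finset.sum_const, sub_self,
      Finset.card_univ, Fintype.card_fin, nsmul_eq_mul] at h
    by_contra! hpos
    have : 0 < Γ.alpha * ((1 : ℕ) * (m : ℝ) ^ 2 + m * (-1) ^ 2) := by positivity
    norm_num at h this
    linarith
  have hβ : (m : ℝ) ≤ Γ.beta := by
    let a : Fin m := ⟨0, by omega⟩
    let b : Fin m := ⟨1, by omega⟩
    have hab : a ≠ b := by simp [a, b]
    -- On zero-sum vectors supported on the complete part the form is m times the squared norm; a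
    -- nonzero one exists because `2 ≤ m`.
    let g : Fin m → ℝ := Pi.single a 1 - Pi.single b 1
    have hg0 : ∑ i, g i = 0 := by simp [g]
    have hg1 : 0 < ∑ i, g i ^ 2 :=
      Finset.sum_pos' (fun i _ => sq_nonneg _) ⟨a, Finset.mem_univ a, by simp [g, hab]⟩
    have h := hb.le_beta_mul hV (z := Sum.elim (fun _ => (0 : ℝ)) g) (by simp [hg0])
    rw [hform] at h
    simp only [Fintype.sum_sum_type, Sum.elim_inl, Sum.elim_inr] at h
    rw [sum_sum_sub_sq g hg0] at h
    refine le_of_mul_le_mul_right ?_ hg1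
    simpa [mul_assoc] using h
  refine le_antisymm hle ?_
  rw [laplacianSpread]
  linarith

end Extremal

end Digraph

theorem corollary4p3 :
    (∀ (V : Type*) [Fintype V] [Nonempty V] (Γ : Digraph V), Γ.IsSimple → Γ.IsBalanced →
      (2 ≤ Fintype.card V →
        IsLeast Γ.laplacianValues Γ.alpha ∧ IsGreatest Γ.laplacianValues Γ.beta) ∧
      Γ.laplacianSpread ≤ (Fintype.card V : ℝ) - 1) ∧
    (∀ n : ℕ, 3 ≤ n →
      Fintype.card (Fin 1 ⊕ Fin (n - 1)) = n ∧
      ((Digraph.simpleComplete 1).disjointUnion (Digraph.simpleComplete (n - 1))).IsSimple ∧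
      ((Digraph.simpleComplete 1).disjointUnion (Digraph.simpleComplete (n - 1))).IsBalanced ∧
      ((Digraph.simpleComplete 1).disjointUnion
        (Digraph.simpleComplete (n - 1))).laplacianSpread = (n : ℝ) - 1) := by
  refine ⟨fun V _ _ Γ _ hb => ⟨fun hV => ⟨hb.isLeast_alpha hV, hb.isGreatest_beta hV⟩,
    hb.laplacianSpread_le⟩, fun n hn => ⟨?_, ?_, ?_, ?_⟩⟩
  · simp; omega
  · exact (Digraph.isSimple_simpleComplete 1).disjointUnion (Digraph.isSimple_simpleComplete _)
  · exact Digraph.isBalanced_disjointUnion_simpleComplete 1 (n - 1)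
  · rw [Digraph.laplacianSpread_disjointUnion_simpleComplete (by omega),
      Nat.cast_sub (by omega), Nat.cast_one]
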